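/- Let $n \ge 1$ be an integer. For every finite group $G$, the set of distributions of all $n$-variable word maps on $G$ determines whether $G$ is nilpotent. Precisely: for a finite group $G$ with a fixed enumeration $g_1,\dots,g_{|G|}$ of its elements, and a word $w$ in the free group $\mathbf{F}_n$ on $x_1,\dots,x_n$, let $w : G^n \to G$ be the induced word map (substitution of group elements for the variables), and let $f_w : \{1,\dots,|G|\} \to \mathbb{N}$ be its distribution, $f_w(i) = |\{\overline{g} \in G^n : w(\overline{g}) = g_i\}|$. Put $D_n(G) = \{ f_w : w \in \mathbf{F}_n \}$, a set of functions on $\{1,\dots,|G|\}$ in which neither the group elements nor the words are recorded. If $G$ and $H$ are finite groups, each with an arbitrary enumeration of its elements, and $D_n(G) = D_n(H)$, then $G$ is nilpotent if and only if $H$ is nilpotent. -/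

import Mathlib

/-- The word map `Gⁿ → G` induced by a word `w` in the free group on `x₀, …, xₙ₋₁`:
substitute `g i` for `xᵢ` and multiply out in `G`. -/
def wordMap {n : ℕ} {G : Type*} [Group G] (w : FreeGroup (Fin n)) (g : Fin n → G) : G :=
  FreeGroup.lift g w

/-- The distribution `f_w` of the word map `w` on a finite group `G` of order `N` whose elements
are enumerated by `e`: the index `i` is sent to the number of `n`-tuples that `w` maps to the
`i`-th element of `G`. -/
noncomputable def wordDistribution {n N : ℕ} {G : Type*} [Group G] (e : Fin N ≃ G)
    (w : FreeGroup (Fin n)) : Fin N → ℕ :=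
  fun i => (wordMap w ⁻¹' {e i}).ncard

/-- The set of distributions of all `n`-variable word maps on `G`, as a set of functions on
`Fin N`. The enumeration `e` is the same for all words, but it is not part of the result. The order
`N` of `G` is recorded (as the common domain of the functions) so that the data of groups of
different orders can be compared. -/
noncomputable def wordDistributions (n : ℕ) {N : ℕ} {G : Type*} [Group G] (e : Fin N ≃ G) :
    Σ N : ℕ, Set (Fin N → ℕ) :=
  ⟨N, Set.range fun w : FreeGroup (Fin n) => wordDistribution e w⟩

/-!
For `n ≥ 2` nilpotency of a finite group `G` can be read off the distributions through the criterion
`isNilpotent_iff_forall_surjective_wordMap`: `G` is nilpotent if and only if every surjective word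
map `Gⁿ → G` has fibres of equal size.

Suppose that `G` is nilpotent and `w` is surjective. The exponent sums of `w` are not all divisible
by a prime `p` dividing `|G|`, as one sees in the abelianization of the Sylow `p`-subgroup. So some
integer combination `∑ aᵢ kᵢ` of the exponent sums `kᵢ` is prime to `|G|`, and then
`u ↦ w (x₁ u ^ a₁, …, xₙ u ^ aₙ)` is a bijection of `G` for every `x`, by induction along the center.
Counting the pairs `(x, u)` for which this value is `g` in two ways shows that all fibres of `w` have
`|G| ^ (n - 1)` elements.

Conversely, let `|G| = q * m` where `q` is the `p`-part of `|G|`. The word `x₀ ^ e * x₁ ^ f`, with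
exponents that project onto the components of order dividing `q` and `m`, is surjective, and its
fibre over `1` has the size of the other fibres only if the numbers `A` of `p`-elements and `B` of
elements of order prime to `p` satisfy `A * B = |G|`. Since `m` divides `B`, which is a case of
Frobenius' theorem (`dvd_card_coprime_orderOf`), this forces `A ≤ q`, so that the Sylow `p`-subgroup
contains all `p`-elements and is normal.

For `n = 1` surjective power maps are bijective and carry no information. Instead, `G` is nilpotent
if and only if for each `p` there is a power map with at most `q` values whose fibre over `1` has
size prime to `p` (`isNilpotent_iff_wordDistributions_one`). The index of the identity can be
recovered from the distributions, because it is the only one lying in all their supports.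
-/

/-! ### Elements of order prime to `p` -/

open Finset in
/-- Summing a class function over a conjugacy class multiplies its value by the index of a
centralizer, so divisibility of a sum of a class function can be tested class by class. -/
theorem dvd_sum_of_dvd_index_centralizer_mul {G : Type*} [Group G] [Fintype G] {f : G → ℕ} {d : ℕ}
    (hf : ∀ g x, f (x * g * x⁻¹) = f g)
    (hd : ∀ g, d ∣ (Subgroup.centralizer {g}).index * f g) : d ∣ ∑ g, f g := by
  classical
  rw [← Finset.sum_fiberwise univ (ConjClasses.mk : G → ConjClasses G) f]
  refine Finset.dvd_sum fun c _ => ?_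
  obtain ⟨g, rfl⟩ := ConjClasses.exists_rep c
  have hconst : ∀ x ∈ ({x | ConjClasses.mk x = ConjClasses.mk g} : Finset G), f x = f g := by
    intro x hx
    obtain ⟨y, hy⟩ := isConj_iff.1 (ConjClasses.mk_eq_mk_iff_isConj.1 (mem_filter.1 hx).2).symm
    rw [← hy, hf]
  have hcard : #({x | ConjClasses.mk x = ConjClasses.mk g} : Finset G)
      = (Subgroup.centralizer {g}).index := by
    have h1 := Subgroup.nat_card_centralizer_nat_card_stabilizer g
    have h2 := (MulAction.stabilizer (ConjAct G) g).card_mul_index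
    rw [← h1, MulAction.index_stabilizer, ConjAct.orbit_eq_carrier_conjClasses] at h2
    have h3 := (Subgroup.centralizer {g}).card_mul_index
    have h4 : Nat.card (ConjAct G) = Nat.card G := rfl
    have h5 : (ConjClasses.mk g).carrier.ncard
        = #({x | ConjClasses.mk x = ConjClasses.mk g} : Finset G) := by
      rw [← Set.ncard_coe_finset]
      congr 1
      ext x
      simp [ConjClasses.mem_carrier_iff_mk_eq]
    rw [← h5]
    exact Nat.eq_of_mul_eq_mul_left Nat.card_pos (by rw [h2, h3, h4])
  rw [Finset.sum_congr rfl hconst, sum_const, smul_eq_mul, hcard]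
  exact hd g

/-- Exponents that split an element of order dividing `q * m` into its commuting components of
orders dividing `q` and `m`. -/
theorem exists_splitting_exponents {q m : ℕ} (h : q.Coprime m) :
    ∃ e f : ℕ, e ≡ 1 [MOD q] ∧ m ∣ e ∧ q ∣ f ∧ f ≡ 1 [MOD m] ∧ e + f ≡ 1 [MOD q * m] := by
  obtain ⟨e, he1, he0⟩ := Nat.chineseRemainder h 1 0
  obtain ⟨f, hf0, hf1⟩ := Nat.chineseRemainder h 0 1
  refine ⟨e, f, he1, Nat.modEq_zero_iff_dvd.1 he0, Nat.modEq_zero_iff_dvd.1 hf0, hf1, ?_⟩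
  exact (Nat.modEq_and_modEq_iff_modEq_mul h).1 ⟨he1.add hf0, he0.add hf1⟩

theorem pow_eq_self_of_modEq_one {G : Type*} [Group G] {x : G} {k e : ℕ} (hx : x ^ k = 1)
    (he : e ≡ 1 [MOD k]) : x ^ e = x := by
  conv_rhs => rw [← pow_one x]
  exact pow_eq_pow_iff_modEq.2 (he.of_dvd (orderOf_dvd_of_pow_eq_one hx))

theorem pow_eq_one_of_dvd {G : Type*} [Monoid G] {x : G} {k e : ℕ} (hx : x ^ k = 1)
    (he : k ∣ e) : x ^ e = 1 :=
  orderOf_dvd_iff_pow_eq_one.1 ((orderOf_dvd_of_pow_eq_one hx).trans he)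

/-- If `|G| = q * m` with `q`, `m` coprime, each element is uniquely a product of commuting
elements `g`, `y` with `g ^ q = 1` and `y ^ m = 1`. -/
theorem card_eq_sum_card_commute {G : Type*} [Group G] [Fintype G] {q m : ℕ} (h : q.Coprime m)
    (hG : Nat.card G = q * m) :
    Nat.card G = ∑ g : G, Nat.card {y : G // g ^ q = 1 ∧ y ^ m = 1 ∧ Commute g y} := by
  obtain ⟨e, f, he1, he0, hf0, hf1, hef⟩ := exists_splitting_exponents h
  have hx (x : G) : x ^ (q * m) = 1 := hG ▸ pow_card_eq_one'
  rw [← Nat.card_sigma]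
  refine Nat.card_congr ⟨fun x => ⟨x ^ e, x ^ f, ?_, ?_, ?_⟩, fun s => s.1 * s.2.1, ?_, ?_⟩
  · rw [← pow_mul]
    exact pow_eq_one_of_dvd (hx x) (mul_comm e q ▸ mul_dvd_mul_left q he0)
  · rw [← pow_mul]
    exact pow_eq_one_of_dvd (hx x) (mul_dvd_mul_right hf0 m)
  · exact (Commute.refl x).pow_pow e f
  · intro x
    change x ^ e * x ^ f = x
    rw [← pow_add]
    exact pow_eq_self_of_modEq_one (hx x) hef
  · rintro ⟨g, y, hg, hy, hc⟩
    have h1 : (g * y) ^ e = g := by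
      rw [hc.mul_pow, pow_eq_self_of_modEq_one hg he1, pow_eq_one_of_dvd hy he0, mul_one]
    have h2 : (g * y) ^ f = y := by
      rw [hc.mul_pow, pow_eq_self_of_modEq_one hy hf1, pow_eq_one_of_dvd hg hf0, one_mul]
    refine Sigma.subtype_ext ?_ ?_
    · exact h1
    · exact h2

theorem pow_eq_one_iff_coprime_orderOf {G : Type*} [Group G] {p a m : ℕ} (hp : p.Prime)
    (hpm : ¬ p ∣ m) (hG : Nat.card G = p ^ a * m) (y : G) :
    y ^ m = 1 ↔ p.Coprime (orderOf y) := by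
  rw [← orderOf_dvd_iff_pow_eq_one]
  constructor
  · intro h
    exact (hp.coprime_iff_not_dvd).2 fun h' => hpm (h'.trans h)
  · intro h
    have h1 : orderOf y ∣ p ^ a * m := hG ▸ orderOf_dvd_natCard y
    exact (Nat.Coprime.pow_left a h).symm.dvd_of_dvd_mul_left h1

/-- A case of Frobenius' theorem: the number of elements of order coprime to `p` is divisible by
every divisor of `|G|` that is coprime to `p`. By induction on `|G|`: in the count of `|G|`
according to `p`-parts, an element `g` contributes the number of elements of order coprime to `p`
in its centralizer. -/
theorem dvd_card_coprime_orderOf {p : ℕ} (hp : p.Prime) (N : ℕ) :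
    ∀ {G : Type*} [Group G] [Finite G], Nat.card G = N → ∀ {d : ℕ}, d ∣ Nat.card G →
      p.Coprime d → d ∣ Nat.card {y : G // p.Coprime (orderOf y)} := by
  induction N using Nat.strong_induction_on with
  | _ N ih =>
  intro G _ _ hN d hd hpd
  classical
  have := Fintype.ofFinite G
  have : Fact p.Prime := ⟨hp⟩
  obtain ⟨a, m, hpm, hG⟩ := Nat.exists_eq_pow_mul_and_not_dvd (Nat.card_pos (α := G)).ne' p hp.ne_one
  have hcop : (p ^ a).Coprime m := Nat.Coprime.pow_left a (hp.coprime_iff_not_dvd.2 hpm)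
  have key := pow_eq_one_iff_coprime_orderOf hp hpm hG
  set F : G → ℕ := fun g => Nat.card {y : G // g ^ p ^ a = 1 ∧ y ^ m = 1 ∧ Commute g y} with hF
  have hsum : Nat.card G = ∑ g, F g := card_eq_sum_card_commute hcop hG
  have hconj (g x : G) : F (x * g * x⁻¹) = F g := by
    refine Nat.card_congr (Equiv.subtypeEquiv (MulAut.conj x).symm.toEquiv fun y => ?_)
    have h1 : (x * g * x⁻¹) ^ p ^ a = 1 ↔ g ^ p ^ a = 1 := by simp [conj_pow]
    have h2 : (x⁻¹ * y * x) ^ m = 1 ↔ y ^ m = 1 := by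
      have := conj_pow (a := x⁻¹) (b := y) (i := m)
      rw [inv_inv] at this
      rw [this]
      rw [mul_eq_one_iff_eq_inv, mul_eq_left]
    have h3 : Commute (x * g * x⁻¹) y ↔ Commute g (x⁻¹ * y * x) := by
      simp only [Commute, SemiconjBy]
      constructor
      · intro h
        simpa [mul_assoc] using congrArg (fun t => x⁻¹ * t * x) h
      · intro h
        simpa [mul_assoc] using congrArg (fun t => x * t * x⁻¹) h
    rw [h1, h3]
    exact and_congr_right' (and_congr_left' h2.symm)
  -- the noncentral elements contribute a multiple of `d`
  have hnc : d ∣ ∑ g, if g ∈ Subgroup.center G then 0 else F g := by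
    refine dvd_sum_of_dvd_index_centralizer_mul (fun g x => ?_) fun g => ?_
    · have : x * g * x⁻¹ ∈ Subgroup.center G ↔ g ∈ Subgroup.center G :=
        ⟨fun h => by simpa [mul_assoc] using Subgroup.Normal.conj_mem inferInstance _ h x⁻¹,
          fun h => Subgroup.Normal.conj_mem inferInstance _ h x⟩
      simp only [this, hconj]
    · split_ifs with hg
      · simp
      by_cases hga : g ^ p ^ a = 1
      swap
      · have : F g = 0 := by simp [hF, hga]
        simp [this]
      set C := Subgroup.centralizer {g}
      have hC : Nat.card C < N := by
        rw [← hN]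
        refine lt_of_le_of_ne (Subgroup.card_le_card_group C) fun h => hg ?_
        have := Subgroup.eq_top_of_card_eq C h
        exact (Subgroup.centralizer_eq_top_iff_subset.1 this) rfl
      have h1 := ih _ hC (G := C) rfl (Nat.gcd_dvd_right d _)
        (hpd.of_dvd_right (Nat.gcd_dvd_left d _))
      have h2 : F g = Nat.card {y : C // p.Coprime (orderOf y)} := by
        refine Nat.card_congr ⟨fun y => ⟨⟨y.1, ?_⟩, ?_⟩, fun y => ⟨y.1.1, hga, ?_, ?_⟩,
          fun _ => rfl, fun _ => rfl⟩
        · exact Subgroup.mem_centralizer_singleton_iff.2 y.2.2.2.symm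
        · rw [← Subgroup.orderOf_coe]
          exact (key _).1 y.2.2.1
        · rw [key, Subgroup.orderOf_coe]
          exact y.2
        · exact (Subgroup.mem_centralizer_singleton_iff.1 y.1.2).symm
      rw [h2]
      refine dvd_trans ?_ (mul_dvd_mul_left _ h1)
      rw [← Nat.gcd_mul_left]
      exact Nat.dvd_gcd (dvd_mul_left _ _) (by rwa [mul_comm, C.card_mul_index])
  -- each central `p`-element contributes the number to be studied
  let T : Subgroup G :=
    { carrier := {g | g ∈ Subgroup.center G ∧ g ^ p ^ a = 1}
      one_mem' := ⟨one_mem _, one_pow _⟩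
      mul_mem' := fun {g y} hg hy => ⟨mul_mem hg.1 hy.1, by
        rw [Commute.mul_pow (Subgroup.mem_center_iff.1 hy.1 g), hg.2, hy.2, one_mul]⟩
      inv_mem' := fun {g} hg => ⟨inv_mem hg.1, by rw [inv_pow, hg.2, inv_one]⟩ }
  have hcen : (∑ g, if g ∈ Subgroup.center G then F g else 0)
      = Nat.card T * Nat.card {y : G // p.Coprime (orderOf y)} := by
    have h1 (g : G) : (if g ∈ Subgroup.center G then F g else 0)
        = if g ∈ Subgroup.center G ∧ g ^ p ^ a = 1 then Nat.card {y : G // p.Coprime (orderOf y)}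
          else 0 := by
      by_cases hg : g ∈ Subgroup.center G <;> by_cases hga : g ^ p ^ a = 1
      · have h2 (y : G) : Commute g y := (Subgroup.mem_center_iff.1 hg y).symm
        simp [hF, hg, hga, h2, key]
      all_goals simp [hF, hg, hga]
    simp only [h1]
    rw [Finset.sum_ite, Finset.sum_const, Finset.sum_const_zero, add_zero, smul_eq_mul]
    congr 1
    rw [← Fintype.card_subtype, ← Nat.card_eq_fintype_card]
    rfl
  have hpg : IsPGroup p T := isPGroup_iff_pow_pow_eq_one.2 fun g => ⟨a, Subtype.ext g.2.2⟩
  obtain ⟨k, hk⟩ := IsPGroup.iff_card.1 hpg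
  have htot : Nat.card G = (∑ g, if g ∈ Subgroup.center G then F g else 0)
      + ∑ g, if g ∈ Subgroup.center G then 0 else F g := by
    rw [hsum, ← Finset.sum_add_distrib]
    refine Finset.sum_congr rfl fun g _ => ?_
    split_ifs <;> simp
  rw [htot, Nat.dvd_add_left hnc, hcen, hk] at hd
  exact (Nat.Coprime.pow_left k hpd).symm.dvd_of_dvd_mul_left hd

/-! ### Nilpotency and the number of `p`-elements -/

theorem Sylow.card_eq_of_card_eq_pow_mul {G : Type*} [Group G] [Finite G] {p a m : ℕ}
    [hp : Fact p.Prime] (P : Sylow p G) (hpm : ¬ p ∣ m) (hG : Nat.card G = p ^ a * m) :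
    Nat.card P = p ^ a := by
  rw [P.card_eq_multiplicity, hG, Nat.factorization_mul (pow_pos hp.out.pos a).ne'
    (by rintro rfl; simp at hpm), hp.out.factorization_pow]
  simp [Nat.factorization_eq_zero_of_not_dvd hpm]

/-- Nilpotency by counting: it suffices that, for each prime `p`, the elements killed by the
`p`-part of `|G|` are no more than that `p`-part. -/
theorem isNilpotent_of_card_pow_eq_one_le {G : Type*} [Group G] [Finite G]
    (h : ∀ p a m : ℕ, p.Prime → ¬ p ∣ m → Nat.card G = p ^ a * m →
      Nat.card {x : G // x ^ p ^ a = 1} ≤ p ^ a) : Group.IsNilpotent G := by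
  refine (Group.isNilpotent_of_finite_tfae.out 0 3 rfl rfl).2 fun p hp P => ?_
  obtain ⟨a, m, hpm, hG⟩ :=
    Nat.exists_eq_pow_mul_and_not_dvd (Nat.card_pos (α := G)).ne' p hp.out.ne_one
  have hP : Nat.card P = p ^ a := P.card_eq_of_card_eq_pow_mul hpm hG
  have hsub : (P : Set G) ⊆ {x | x ^ p ^ a = 1} := by
    intro x hx
    have : (⟨x, hx⟩ : P) ^ Nat.card P = 1 := pow_card_eq_one'
    rw [hP] at this
    exact congrArg Subtype.val this
  have heq : (P : Set G) = {x | x ^ p ^ a = 1} :=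
    Set.eq_of_subset_of_ncard_le hsub ((h p a m hp.out hpm hG).trans_eq hP.symm)
  refine ⟨fun x hx g => ?_⟩
  have hx' : x ∈ {x : G | x ^ p ^ a = 1} := heq ▸ hx
  have : g * x * g⁻¹ ∈ (P : Set G) := by
    rw [heq, Set.mem_ofPred_eq, conj_pow, show x ^ p ^ a = 1 from hx']
    simp
  exact this

theorem card_pow_eq_one_of_isNilpotent {G : Type*} [Group G] [Finite G] [Group.IsNilpotent G]
    {p a m : ℕ} (hp : p.Prime) (hpm : ¬ p ∣ m) (hG : Nat.card G = p ^ a * m) :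
    Nat.card {x : G // x ^ p ^ a = 1} = p ^ a := by
  have : Fact p.Prime := ⟨hp⟩
  let P : Sylow p G := default
  have hP : Nat.card P = p ^ a := P.card_eq_of_card_eq_pow_mul hpm hG
  have hn : (P : Subgroup G).Normal :=
    (Group.isNilpotent_of_finite_tfae.out 0 3 rfl rfl).1 ‹_› p this P
  have := P.unique_of_normal hn
  refine Eq.trans (Nat.card_congr (Equiv.subtypeEquivRight fun x => ⟨fun hx => ?_, fun hx => ?_⟩)) hP
  · have hz : IsPGroup p (Subgroup.zpowers x) := by
      refine IsPGroup.of_card_dvd_pow (n := a) ?_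
      rw [Nat.card_zpowers]
      exact orderOf_dvd_of_pow_eq_one hx
    obtain ⟨Q, hQ⟩ := hz.exists_le_sylow
    exact (Subsingleton.elim Q P) ▸ hQ (Subgroup.mem_zpowers x)
  · have : (⟨x, hx⟩ : P) ^ Nat.card P = 1 := pow_card_eq_one'
    rw [hP] at this
    exact congrArg Subtype.val this

/-! ### Exponent sums of words -/

/-- The exponent sum of the letter `i` in the word `w`. -/
def expSum {n : ℕ} (w : FreeGroup (Fin n)) (i : Fin n) : ℤ :=
  Multiplicative.toAdd (FreeGroup.lift (Pi.mulSingle i (Multiplicative.ofAdd 1)) w)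

@[simp]
theorem expSum_one {n : ℕ} (i : Fin n) : expSum (1 : FreeGroup (Fin n)) i = 0 := by
  simp [expSum]

@[simp]
theorem expSum_mul {n : ℕ} (v w : FreeGroup (Fin n)) (i : Fin n) :
    expSum (v * w) i = expSum v i + expSum w i := by
  simp [expSum]

@[simp]
theorem expSum_inv {n : ℕ} (w : FreeGroup (Fin n)) (i : Fin n) :
    expSum w⁻¹ i = -expSum w i := by
  simp [expSum]

theorem expSum_of {n : ℕ} (i j : Fin n) :
    expSum (FreeGroup.of j) i = if i = j then 1 else 0 := by
  by_cases h : i = j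
  · simp [expSum, h]
  · simp [expSum, h]

theorem map_wordMap {n : ℕ} {G H : Type*} [Group G] [Group H] (φ : G →* H)
    (w : FreeGroup (Fin n)) (x : Fin n → G) : φ (wordMap w x) = wordMap w (φ ∘ x) := by
  have : φ.comp (FreeGroup.lift x) = FreeGroup.lift (φ ∘ x) := by ext; simp
  exact DFunLike.congr_fun this w

theorem wordMap_one {n : ℕ} {G : Type*} [Group G] (w : FreeGroup (Fin n)) :
    wordMap w (1 : Fin n → G) = 1 := by
  have := map_wordMap (1 : G →* G) w 1
  rw [show (1 : G →* G) ∘ (1 : Fin n → G) = 1 from rfl] at this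
  exact this.symm

theorem wordMap_eq_prod_zpow {n : ℕ} {A : Type*} [CommGroup A] (w : FreeGroup (Fin n))
    (x : Fin n → A) : wordMap w x = ∏ i, x i ^ expSum w i := by
  unfold wordMap
  induction w using FreeGroup.induction_on with
  | C1 => simp
  | of j => simp [expSum_of]
  | inv_of j h => simp [expSum_of]
  | mul v w hv hw => simp [hv, hw, zpow_add, Finset.prod_mul_distrib]

theorem wordMap_mul_zpow_of_mem_center {n : ℕ} {G : Type*} [Group G] (w : FreeGroup (Fin n))
    (x : Fin n → G) (a : Fin n → ℤ) {z : G} (hz : z ∈ Subgroup.center G) :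
    wordMap w (fun i => x i * z ^ a i) = wordMap w x * z ^ ∑ i, a i * expSum w i := by
  have hc (g : G) (k : ℤ) : Commute (z ^ k) g :=
    Commute.zpow_left (Subgroup.mem_center_iff.1 hz g).symm k
  unfold wordMap
  induction w using FreeGroup.induction_on with
  | C1 => simp
  | of j => simp [expSum_of]
  | inv_of j h => simpa [expSum_of] using ((hc (x j)⁻¹ (a j)).inv_left).eq
  | mul v w hv hw =>
    simp only [map_mul, hv, hw, expSum_mul, mul_add, Finset.sum_add_distrib, zpow_add]
    rw [mul_assoc, ← mul_assoc (z ^ _) (FreeGroup.lift x w), (hc (FreeGroup.lift x w) _).eq]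
    simp only [mul_assoc]

/-! ### Word maps on nilpotent groups -/

/-- In a nilpotent group, moving the arguments of a word by powers of a common element `u` whose
total exponent is prime to `|G|` is injective in `u`. By induction on the nilpotency class: two
solutions differ by a central element `z`, which multiplies the value by a power of `z`. -/
theorem injective_wordMap_mul_zpow {n : ℕ} (w : FreeGroup (Fin n)) (a : Fin n → ℤ)
    (G : Type*) [Group G] [Group.IsNilpotent G] : Finite G →
    IsCoprime (∑ i, a i * expSum w i) (Nat.card G : ℤ) → ∀ x : Fin n → G,
    Function.Injective fun u : G => wordMap w fun i => x i * u ^ a i := by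
  refine Group.nilpotent_center_quotient_ind (P := fun G _ _ => Finite G →
    IsCoprime (∑ i, a i * expSum w i) (Nat.card G : ℤ) → ∀ x : Fin n → G,
    Function.Injective fun u : G => wordMap w fun i => x i * u ^ a i) G ?_ ?_
  · exact fun _ _ _ _ _ _ => Function.injective_of_subsingleton _
  · intro G _ _ ih _ hG x u v huv
    have hquot := ih inferInstance (hG.of_isCoprime_of_dvd_right (by
      exact_mod_cast (Subgroup.center G).card_quotient_dvd_card)) (fun i => (x i : G ⧸ _))
    have hmap (u : G) : ((wordMap w fun i => x i * u ^ a i : G) : G ⧸ Subgroup.center G)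
        = wordMap w fun i => (x i : G ⧸ Subgroup.center G) * (u : G ⧸ Subgroup.center G) ^ a i :=
      map_wordMap (QuotientGroup.mk' (Subgroup.center G)) w _
    -- `u` and `v` agree modulo the center by the induction hypothesis
    have hz : u⁻¹ * v ∈ Subgroup.center G := by
      refine QuotientGroup.eq.1 (hquot ?_)
      change wordMap w _ = wordMap w _
      rw [← hmap, ← hmap]
      exact congrArg _ huv
    obtain ⟨z, hz', rfl⟩ : ∃ z ∈ Subgroup.center G, v = u * z := ⟨_, hz, by simp⟩
    have hmul (k : ℤ) : (u * z) ^ k = u ^ k * z ^ k :=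
      Commute.mul_zpow (Subgroup.mem_center_iff.1 hz' u) k
    simp only [hmul, ← mul_assoc] at huv
    rw [wordMap_mul_zpow_of_mem_center w _ a hz', left_eq_mul] at huv
    have : z = 1 := by
      obtain ⟨s, t, hst⟩ := hG
      rw [← zpow_one z, ← hst, zpow_add, zpow_mul', zpow_mul', huv, zpow_natCast, pow_card_eq_one']
      simp
    simp [this]

/-- If the exponent sums of `w` have a combination prime to `|G|`, then every fibre of `w` on the
nilpotent group `G` has the same size: the pairs `(x, u)` such that moving `x` by powers of `u`
gives a solution of `w = g` are counted in two ways. -/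
theorem card_wordMap_fiber_mul_card {n : ℕ} (w : FreeGroup (Fin n)) (a : Fin n → ℤ)
    {G : Type*} [Group G] [Finite G] [Group.IsNilpotent G]
    (h : IsCoprime (∑ i, a i * expSum w i) (Nat.card G : ℤ)) (g : G) :
    Nat.card {x : Fin n → G // wordMap w x = g} * Nat.card G = Nat.card G ^ n := by
  have hbij (x : Fin n → G) : Function.Bijective fun u : G => wordMap w fun i => x i * u ^ a i :=
    Finite.injective_iff_bijective.1 (injective_wordMap_mul_zpow w a G inferInstance h x)
  have e : {x : Fin n → G // wordMap w x = g} × G ≃ (Fin n → G) :=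
    { toFun := fun s i => s.1.1 i * (s.2 ^ a i)⁻¹
      invFun := fun x =>
        let u := (Equiv.ofBijective _ (hbij x)).symm g
        (⟨fun i => x i * u ^ a i, (Equiv.ofBijective _ (hbij x)).apply_symm_apply g⟩, u)
      left_inv := by
        rintro ⟨⟨x, hx⟩, u⟩
        have hu : (Equiv.ofBijective _ (hbij fun i => x i * (u ^ a i)⁻¹)).symm g = u := by
          rw [Equiv.symm_apply_eq]
          simp [hx]
        simp [hu]
      right_inv := by
        intro x
        simp }
  rw [← Nat.card_prod, Nat.card_congr e]
  rw [Nat.card_fun, Nat.card_fin]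

/-- A word whose exponent sums are all divisible by a prime `p` is not surjective on a nilpotent
group of order divisible by `p`: on the abelianization of the Sylow `p`-subgroup, which is a
quotient of the group, its values are `p`-th powers. -/
theorem not_surjective_wordMap_of_dvd_expSum {n : ℕ} (w : FreeGroup (Fin n))
    {G : Type*} [Group G] [Finite G] [hnil : Group.IsNilpotent G] {p : ℕ} (hp : p.Prime)
    (hpG : p ∣ Nat.card G) (hw : ∀ i, (p : ℤ) ∣ expSum w i) :
    ¬ Function.Surjective (wordMap w : (Fin n → G) → G) := by
  intro hsurj
  have : Fact p.Prime := ⟨hp⟩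
  obtain ⟨E⟩ : Nonempty
      ((∀ p : (Nat.card G).primeFactors, ∀ P : Sylow p G, (↑P : Subgroup G)) ≃* G) :=
    (Group.isNilpotent_of_finite_tfae.out 0 4 rfl rfl).1 hnil
  let P : Sylow p G := default
  let p' : (Nat.card G).primeFactors := ⟨p, Nat.mem_primeFactors.2 ⟨hp, hpG, Nat.card_pos.ne'⟩⟩
  let A := Abelianization P
  have hPnt : Nontrivial P := by
    by_contra hne
    rw [not_nontrivial_iff_subsingleton] at hne
    exact P.ne_bot_of_dvd_card hpG ((P : Subgroup G).eq_bot_iff_card.2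
      (Nat.card_eq_one_iff_unique.2 ⟨hne, inferInstance⟩))
  let φ : G →* A := MonoidHom.mk' (fun g => Abelianization.of (E.symm g p' P)) fun g h => by
    rw [map_mul E.symm]
    exact map_mul Abelianization.of _ _
  have hφ : Function.Surjective φ := by
    intro y
    obtain ⟨z, rfl⟩ := QuotientGroup.mk'_surjective _ y
    obtain ⟨f, hf⟩ := Function.surjective_eval (β := fun P : Sylow p G => (P : Subgroup G)) P z
    obtain ⟨f', hf'⟩ := Function.surjective_eval (β := fun q : (Nat.card G).primeFactors =>
      ∀ P : Sylow q G, (P : Subgroup G)) p' f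
    refine ⟨E f', ?_⟩
    change Abelianization.of (E.symm (E f') p' P) = _
    rw [E.symm_apply_apply, ← hf, ← hf']
    rfl
  have hnt : Nontrivial A := by
    have : Group.IsNilpotent P := inferInstance
    have hlt := Group.IsSolvable.commutator_lt_top_of_nontrivial P
    exact QuotientGroup.nontrivial_iff.2 hlt.ne
  have hA : IsPGroup p A := P.isPGroup'.of_surjective _ (QuotientGroup.mk'_surjective _)
  have hpow : Function.Surjective fun y : A => y ^ p := by
    intro y
    obtain ⟨g, rfl⟩ := hφ y
    obtain ⟨x, rfl⟩ := hsurj g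
    choose k hk using hw
    refine ⟨∏ i, φ (x i) ^ k i, ?_⟩
    rw [map_wordMap, wordMap_eq_prod_zpow]
    simp only [hk, Function.comp]
    rw [← Finset.prod_pow]
    exact Finset.prod_congr rfl fun i _ => by rw [mul_comm, zpow_mul, zpow_natCast]
  have hinj := Finite.injective_iff_surjective.2 hpow
  have hpA : p ∣ Nat.card A := by
    obtain ⟨k, hk, hk'⟩ := hA.nontrivial_iff_card.1 hnt
    exact hk' ▸ dvd_pow_self p hk.ne'
  obtain ⟨y, hy⟩ := exists_prime_orderOf_dvd_card' p hpA
  have : y = 1 := hinj (by simp [← hy, pow_orderOf_eq_one])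
  rw [this, orderOf_one] at hy
  exact hp.one_lt.ne hy

theorem Group.IsNilpotent.card_wordMap_fiber_of_surjective {n : ℕ} (w : FreeGroup (Fin n))
    {G : Type*} [Group G] [Finite G] [Group.IsNilpotent G]
    (hw : Function.Surjective (wordMap w : (Fin n → G) → G)) (g : G) :
    Nat.card {x : Fin n → G // wordMap w x = g} * Nat.card G = Nat.card G ^ n := by
  -- Bézout coefficients `a` for the greatest common divisor of the exponent sums
  let I := Ideal.span (Set.range (expSum w))
  let d := Submodule.IsPrincipal.generator I
  obtain ⟨a, ha⟩ := Ideal.mem_span_range_iff_exists_fun.1 (Submodule.IsPrincipal.generator_mem I)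
  refine card_wordMap_fiber_mul_card w a ?_ g
  rw [ha, Int.isCoprime_iff_gcd_eq_one]
  refine Nat.coprime_of_dvd fun p hp hpd hpG => ?_
  refine not_surjective_wordMap_of_dvd_expSum w hp (by simpa using hpG) (fun i => ?_) hw
  refine (Int.natCast_dvd.2 hpd).trans ?_
  exact (Submodule.IsPrincipal.mem_iff_generator_dvd I).1 (Ideal.subset_span ⟨i, rfl⟩)

/-! ### Solutions of equations `x ^ k = 1` and uniform word maps -/

/-- If `p` divides both `k` and `|G|`, the number of solutions of `x ^ k = 1` is divisible by `p`:
modulo `p` only the solutions commuting with a fixed element `z` of order `p` count, and these are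
permuted without fixed points by multiplication by `z`. -/
theorem prime_dvd_card_zpow_eq_one {G : Type*} [Group G] [Finite G] {p : ℕ} (hp : p.Prime) {k : ℤ}
    (hk : (p : ℤ) ∣ k) (hpG : p ∣ Nat.card G) : p ∣ Nat.card {x : G // x ^ k = 1} := by
  classical
  have := Fintype.ofFinite G
  have : Fact p.Prime := ⟨hp⟩
  obtain ⟨z, hz⟩ := exists_prime_orderOf_dvd_card' p hpG
  have hzp : z ^ p = 1 := hz ▸ pow_orderOf_eq_one z
  have hzk : z ^ k = 1 := orderOf_dvd_iff_zpow_eq_one.1 (hz ▸ hk)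
  let σ : Function.End {x : G // x ^ k = 1} := fun x => ⟨z * x * z⁻¹, by simp [conj_zpow, x.2]⟩
  have hσ (j : ℕ) (x : {x : G // x ^ k = 1}) : ((σ ^ j) x : G) = z ^ j * x * (z ^ j)⁻¹ := by
    induction j with
    | zero => simp; rfl
    | succ j ih =>
      rw [pow_succ' σ]
      change z * ((σ ^ j) x : G) * z⁻¹ = _
      rw [ih, pow_succ']
      group
  let τ : Function.End {x : G // x ^ k = 1 ∧ Commute z x} := fun x =>
    ⟨z * x, by rw [x.2.2.mul_zpow, hzk, x.2.1, one_mul], (Commute.refl z).mul_right x.2.2⟩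
  have hτ (j : ℕ) (x : {x : G // x ^ k = 1 ∧ Commute z x}) : ((τ ^ j) x : G) = z ^ j * x := by
    induction j with
    | zero => simp; rfl
    | succ j ih =>
      rw [pow_succ' τ]
      change z * ((τ ^ j) x : G) = _
      rw [ih, pow_succ', mul_assoc]
  have h1 := Equiv.Perm.card_fixedPoints_modEq (f := σ) (p := p) (n := 1)
    (funext fun x => Subtype.ext (by rw [pow_one, hσ, hzp]; simp; rfl))
  have h2 := Equiv.Perm.card_fixedPoints_modEq (f := τ) (p := p) (n := 1)
    (funext fun x => Subtype.ext (by rw [pow_one, hτ, hzp]; simp; rfl))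
  have h3 : Fintype.card (Function.fixedPoints σ)
      = Fintype.card {x : G // x ^ k = 1 ∧ Commute z x} := by
    refine Fintype.card_congr ((Equiv.subtypeSubtypeEquivSubtypeInter (fun x : G => x ^ k = 1)
      (fun x => Commute z x)).symm.trans (Equiv.subtypeEquivRight fun x => ?_)).symm
    change Commute z (x : G) ↔ σ x = x
    rw [Subtype.ext_iff]
    exact mul_inv_eq_iff_eq_mul.symm
  have h4 : Fintype.card (Function.fixedPoints τ) = 0 := by
    refine Fintype.card_eq_zero_iff.2 ⟨fun x => ?_⟩
    have h5 : z * (x.1 : G) = x.1 := congrArg Subtype.val x.2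
    rw [mul_eq_right] at h5
    rw [h5, orderOf_one] at hz
    exact hp.one_lt.ne hz
  rw [Nat.card_eq_fintype_card]
  exact Nat.modEq_zero_iff_dvd.1 ((h1.trans (by rw [h3])).trans (h2.trans (by rw [h4])))

theorem pow_eq_one_iff_of_modEq_one {G : Type*} [Group G] {x : G} {q m e : ℕ}
    (hx : x ^ (q * m) = 1) (he1 : e ≡ 1 [MOD q]) (he0 : m ∣ e) : x ^ e = 1 ↔ x ^ m = 1 := by
  refine ⟨fun h => ?_, fun h => pow_eq_one_of_dvd h he0⟩
  rw [← orderOf_dvd_iff_pow_eq_one] at h hx ⊢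
  have heq : e.Coprime q := by
    rw [Nat.Coprime, he1.gcd_eq, Nat.gcd_one_left]
  exact (heq.of_dvd_left h).dvd_of_dvd_mul_left hx

/-- If every surjective word map in `n ≥ 2` variables has fibres of equal size, then the numbers of
solutions of `x ^ q = 1` and `x ^ m = 1`, for `|G| = q * m` a coprime factorization, have product
`|G|`. The word used is `x₀ ^ e * x₁ ^ f`, where the exponents `e` and `f` pick out the components
of order dividing `q` and `m`: it is surjective, and its value is trivial only if both factors
are. -/
theorem card_pow_eq_one_mul_card_pow_eq_one {n : ℕ} (hn : 2 ≤ n) {G : Type*} [Group G] [Finite G]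
    (hU : ∀ w : FreeGroup (Fin n), Function.Surjective (wordMap w : (Fin n → G) → G) →
      ∀ g, Nat.card {x : Fin n → G // wordMap w x = g} * Nat.card G = Nat.card G ^ n)
    {q m : ℕ} (h : q.Coprime m) (hG : Nat.card G = q * m) :
    Nat.card {x : G // x ^ q = 1} * Nat.card {x : G // x ^ m = 1} = Nat.card G := by
  obtain ⟨k, rfl⟩ := Nat.exists_eq_add_of_le' hn
  obtain ⟨e, f, he1, he0, hf0, hf1, hef⟩ := exists_splitting_exponents h
  have hx (x : G) : x ^ (q * m) = 1 := hG ▸ pow_card_eq_one'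
  let w : FreeGroup (Fin (k + 2)) := FreeGroup.of 0 ^ e * FreeGroup.of 1 ^ f
  have hw (x : Fin (k + 2) → G) : wordMap w x = x 0 ^ e * x 1 ^ f := by simp [wordMap, w]
  have hwx (g : G) : g ^ e * g ^ f = g := by
    rw [← pow_add]
    exact pow_eq_self_of_modEq_one (hx g) hef
  have hsurj : Function.Surjective (wordMap w : (Fin (k + 2) → G) → G) :=
    fun g => ⟨fun _ => g, by rw [hw, hwx]⟩
  have heq (g : G) : (g ^ e) ^ q = 1 := by
    rw [← pow_mul]
    exact pow_eq_one_of_dvd (hx g) (mul_comm e q ▸ mul_dvd_mul_left q he0)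
  have hfm (g : G) : (g ^ f) ^ m = 1 := by
    rw [← pow_mul]
    exact pow_eq_one_of_dvd (hx g) (mul_dvd_mul_right hf0 m)
  have he (g : G) : g ^ e = 1 ↔ g ^ m = 1 := pow_eq_one_iff_of_modEq_one (hx g) he1 he0
  have hf (g : G) : g ^ f = 1 ↔ g ^ q = 1 :=
    pow_eq_one_iff_of_modEq_one (mul_comm q m ▸ hx g) hf1 hf0
  have hfib (x : Fin (k + 2) → G) : wordMap w x = 1 ↔ x 0 ^ m = 1 ∧ x 1 ^ q = 1 := by
    rw [hw, ← he, ← hf]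
    refine ⟨fun h1 => ?_, fun h1 => by rw [h1.1, h1.2, one_mul]⟩
    -- the order of `x 0 ^ e = (x 1 ^ f)⁻¹` divides both `q` and `m`
    have h2 : x 0 ^ e = 1 := by
      have h3 : (x 0 ^ e) ^ m = 1 := by
        rw [eq_inv_of_mul_eq_one_left h1, inv_pow, hfm, inv_one]
      have h4 := pow_gcd_eq_one.2 ⟨heq (x 0), h3⟩
      rwa [h, pow_one] at h4
    exact ⟨h2, by rwa [h2, one_mul] at h1⟩
  have hequiv : {x : Fin (k + 2) → G // wordMap w x = 1}
      ≃ {x : G // x ^ m = 1} × {x : G // x ^ q = 1} × (Fin k → G) :=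
    { toFun := fun x => (⟨x.1 0, ((hfib _).1 x.2).1⟩, ⟨x.1 1, ((hfib _).1 x.2).2⟩,
        fun i => x.1 i.succ.succ)
      invFun := fun s => ⟨Fin.cons s.1 (Fin.cons s.2.1 s.2.2), (hfib _).2 ⟨s.1.2, s.2.1.2⟩⟩
      left_inv := fun x => Subtype.ext (funext fun i => by
        refine Fin.cases rfl (fun i => ?_) i
        exact Fin.cases rfl (fun i => rfl) i)
      right_inv := fun s => rfl }
  have hcount := hU w hsurj 1
  rw [Nat.card_congr hequiv, Nat.card_prod, Nat.card_prod, Nat.card_fun, Nat.card_fin] at hcount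
  refine Nat.eq_of_mul_eq_mul_right (pow_pos (Nat.card_pos (α := G)) (k + 1)) ?_
  linear_combination hcount

theorem card_pow_compl_eq_one_of_isNilpotent {G : Type*} [Group G] [Finite G]
    [Group.IsNilpotent G] {p a m : ℕ} (hp : p.Prime) (hpm : ¬ p ∣ m)
    (hG : Nat.card G = p ^ a * m) : Nat.card {x : G // x ^ m = 1} = m := by
  have h1 := card_pow_eq_one_mul_card_pow_eq_one (n := 2) le_rfl
    (fun w hw g => Group.IsNilpotent.card_wordMap_fiber_of_surjective w (G := G) hw g)
    (Nat.Coprime.pow_left a (hp.coprime_iff_not_dvd.2 hpm)) hG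
  rw [card_pow_eq_one_of_isNilpotent hp hpm hG, hG] at h1
  exact Nat.eq_of_mul_eq_mul_left (pow_pos hp.pos a) h1

/-- A finite group is nilpotent if and only if each of its surjective word maps in `n ≥ 2` variables
has fibres of equal size. -/
theorem isNilpotent_iff_forall_surjective_wordMap {n : ℕ} (hn : 2 ≤ n) {G : Type*} [Group G]
    [Finite G] : Group.IsNilpotent G ↔
      ∀ w : FreeGroup (Fin n), Function.Surjective (wordMap w : (Fin n → G) → G) →
        ∀ g, Nat.card {x : Fin n → G // wordMap w x = g} * Nat.card G = Nat.card G ^ n := by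
  refine ⟨fun _ w hw g => Group.IsNilpotent.card_wordMap_fiber_of_surjective w hw g, fun hU => ?_⟩
  refine isNilpotent_of_card_pow_eq_one_le fun p a m hp hpm hG => ?_
  have hcop := Nat.Coprime.pow_left a (hp.coprime_iff_not_dvd.2 hpm)
  have h1 := card_pow_eq_one_mul_card_pow_eq_one hn hU hcop hG
  have h2 : m ∣ Nat.card {x : G // x ^ m = 1} := by
    rw [Nat.card_congr (Equiv.subtypeEquivRight (pow_eq_one_iff_coprime_orderOf hp hpm hG))]
    exact dvd_card_coprime_orderOf hp _ rfl ⟨_, hG.trans (mul_comm _ _)⟩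
      (hp.coprime_iff_not_dvd.2 hpm)
  have : Nonempty {x : G // x ^ m = 1} := ⟨⟨1, one_pow m⟩⟩
  have h3 := Nat.le_of_dvd Nat.card_pos h2
  have hm : 0 < m := Nat.pos_of_ne_zero (by rintro rfl; simp at hpm)
  refine Nat.le_of_mul_le_mul_right ?_ hm
  rw [← hG, ← h1]
  exact Nat.mul_le_mul_left _ h3

/-! ### Reading nilpotency off the distributions -/

theorem wordDistribution_apply {n N : ℕ} {G : Type*} [Group G] (e : Fin N ≃ G)
    (w : FreeGroup (Fin n)) (i : Fin N) :
    wordDistribution e w i = Nat.card {x : Fin n → G // wordMap w x = e i} := rfl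

theorem wordDistribution_ne_zero_iff {n N : ℕ} {G : Type*} [Group G] [Finite G] (e : Fin N ≃ G)
    (w : FreeGroup (Fin n)) (i : Fin N) :
    wordDistribution e w i ≠ 0 ↔ ∃ x : Fin n → G, wordMap w x = e i := by
  rw [wordDistribution_apply, Nat.card_ne_zero, nonempty_subtype]
  exact and_iff_left inferInstance

theorem isNilpotent_iff_wordDistributions_of_two_le {n : ℕ} (hn : 2 ≤ n) {N : ℕ} {G : Type*}
    [Group G] (e : Fin N ≃ G) : Group.IsNilpotent G ↔
      ∀ f ∈ (wordDistributions n e).2, (∀ i, f i ≠ 0) →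
        ∀ i, f i * (wordDistributions n e).1 = (wordDistributions n e).1 ^ n := by
  have : Finite G := Finite.of_equiv _ e
  have hN : Nat.card G = N := by rw [← Nat.card_congr e, Nat.card_fin]
  rw [isNilpotent_iff_forall_surjective_wordMap hn]
  change _ ↔ ∀ f ∈ Set.range (wordDistribution e), (∀ i, f i ≠ 0) → ∀ i, f i * N = N ^ n
  rw [Set.forall_mem_range]
  refine forall_congr' fun w => ?_
  have hs : Function.Surjective (wordMap w : (Fin n → G) → G) ↔
      ∀ i, wordDistribution e w i ≠ 0 := by
    simp only [wordDistribution_ne_zero_iff]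
    exact (e.forall_congr_right (q := fun g => ∃ x, wordMap w x = g)).symm
  rw [hs, hN]
  exact imp_congr_right fun _ => (e.forall_congr_right
    (q := fun g => Nat.card {x : Fin n → G // wordMap w x = g} * N = N ^ n)).symm

/-- In one variable, nilpotency is detected by the power maps `x ↦ x ^ k` with at most `p ^ a`
values whose fibre over `1` has size prime to `p`, where `p ^ a` is the `p`-part of `|G|`: if
`p` divides `|G|`, then it does not divide `k`, hence all elements of `p`-power order are values. The
index of the identity is recognized as the one that lies in the support of every distribution. -/
theorem isNilpotent_iff_wordDistributions_one {N : ℕ} {G : Type*} [Group G] (e : Fin N ≃ G) :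
    Group.IsNilpotent G ↔ ∀ p a m : ℕ, p.Prime → ¬ p ∣ m →
      (wordDistributions 1 e).1 = p ^ a * m → ∃ f ∈ (wordDistributions 1 e).2,
        {i | f i ≠ 0}.ncard ≤ p ^ a ∧
          ∀ i, (∀ g ∈ (wordDistributions 1 e).2, g i ≠ 0) → ¬ p ∣ f i := by
  have : Finite G := Finite.of_equiv _ e
  have hN : Nat.card G = N := by rw [← Nat.card_congr e, Nat.card_fin]
  have hw (w : FreeGroup (Fin 1)) (x : Fin 1 → G) : wordMap w x = x 0 ^ expSum w 0 := by
    have : FreeGroup.lift x = (zpowersHom G (x 0)).comp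
        (FreeGroup.lift (Pi.mulSingle 0 (Multiplicative.ofAdd 1))) := by
      ext i
      simp [Subsingleton.elim i 0]
    exact DFunLike.congr_fun this w
  have hone (w : FreeGroup (Fin 1)) : wordDistribution e w (e.symm 1)
      = Nat.card {x : G // x ^ expSum w 0 = 1} := by
    rw [wordDistribution_apply]
    refine Nat.card_congr (Equiv.subtypeEquiv (Equiv.funUnique (Fin 1) G) fun x => ?_)
    simp [hw]
  have hsupp (w : FreeGroup (Fin 1)) : {i | wordDistribution e w i ≠ 0}.ncard
      = (Set.range fun x : G => x ^ expSum w 0).ncard := by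
    rw [← Set.ncard_image_of_injective _ e.injective]
    congr 1
    ext g
    simp only [wordDistribution_ne_zero_iff, hw]
    constructor
    · rintro ⟨i, ⟨x, hx⟩, rfl⟩
      exact ⟨x 0, hx⟩
    · rintro ⟨x, rfl⟩
      exact ⟨e.symm (x ^ expSum w 0), ⟨fun _ => x, by simp⟩, by simp⟩
  change _ ↔ ∀ p a m : ℕ, p.Prime → ¬ p ∣ m → N = p ^ a * m →
    ∃ f ∈ Set.range (wordDistribution (n := 1) e), {i | f i ≠ 0}.ncard ≤ p ^ a ∧
      ∀ i, (∀ g ∈ Set.range (wordDistribution (n := 1) e), g i ≠ 0) → ¬ p ∣ f i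
  simp only [Set.forall_mem_range, Set.exists_range_iff, hsupp]
  constructor
  · intro _ p a m hp hpm hG
    rw [← hN] at hG
    have hcop := Nat.Coprime.pow_left a (hp.coprime_iff_not_dvd.2 hpm)
    have hx (x : G) : x ^ (p ^ a * m) = 1 := hG ▸ pow_card_eq_one'
    obtain ⟨k, -, hk1, hk0, -⟩ := exists_splitting_exponents hcop
    have hsum : expSum (FreeGroup.of (0 : Fin 1) ^ k) 0 = k := by simp [expSum]
    refine ⟨FreeGroup.of 0 ^ k, ?_, fun i hi => ?_⟩
    · rw [hsum, ← card_pow_eq_one_of_isNilpotent hp hpm hG]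
      refine Set.ncard_le_ncard (t := {x : G | x ^ p ^ a = 1}) ?_
      rintro _ ⟨x, rfl⟩
      change (x ^ (k : ℤ)) ^ p ^ a = 1
      rw [zpow_natCast, ← pow_mul]
      exact pow_eq_one_of_dvd (hx x) (mul_comm k _ ▸ mul_dvd_mul_left _ hk0)
    -- the trivial word is supported on the identity only
    · obtain ⟨x, hx1⟩ := (wordDistribution_ne_zero_iff e _ i).1 (hi 1)
      have hi1 : i = e.symm 1 := by
        rw [Equiv.eq_symm_apply, ← hx1]
        exact map_one (FreeGroup.lift x)
      rw [hi1, hone, hsum]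
      simp only [zpow_natCast, pow_eq_one_iff_of_modEq_one (hx _) hk1 hk0]
      rwa [card_pow_compl_eq_one_of_isNilpotent hp hpm hG]
  · intro h
    refine isNilpotent_of_card_pow_eq_one_le fun p a m hp hpm hG => ?_
    obtain ⟨w, hle, hdvd⟩ := h p a m hp hpm (hN.symm.trans hG)
    replace hdvd := hdvd (e.symm 1) fun v =>
      (wordDistribution_ne_zero_iff e v _).2 ⟨1, by rw [wordMap_one, e.apply_symm_apply]⟩
    rw [hone] at hdvd
    refine le_trans ?_ hle
    refine Set.ncard_le_ncard (s := {x | x ^ p ^ a = 1}) fun x (hx : x ^ p ^ a = 1) => ?_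
    -- every `p`-element is a value of the power map, because `p` does not divide its exponent
    obtain rfl | ha := eq_or_ne a 0
    · exact ⟨1, by simpa using hx.symm⟩
    have hpk : ¬ (p : ℤ) ∣ expSum w 0 := fun hpk =>
      hdvd (prime_dvd_card_zpow_eq_one hp hpk (hG ▸ (dvd_pow_self p ha).mul_right m))
    obtain ⟨s, t, hst⟩ : IsCoprime (expSum w 0) ((p : ℤ) ^ a) :=
      (((Nat.prime_iff_prime_int.1 hp).coprime_iff_not_dvd.2 hpk).pow_left).symm
    refine ⟨x ^ s, ?_⟩
    change (x ^ s) ^ expSum w 0 = x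
    have hx' : x ^ ((p : ℤ) ^ a) = 1 := by exact_mod_cast hx
    rw [← zpow_mul, ← mul_one (x ^ _), ← one_zpow t, ← hx', ← zpow_mul, mul_comm _ t,
      ← zpow_add, hst, zpow_one]

theorem mainTheorem2 (n : ℕ) (hn : 1 ≤ n) {G : Type*} {H : Type*} [Group G] [Group H]
    {M N : ℕ} (eG : Fin M ≃ G) (eH : Fin N ≃ H)
    (h : wordDistributions n eG = wordDistributions n eH) :
    Group.IsNilpotent G ↔ Group.IsNilpotent H := by
  obtain rfl | hn := hn.eq_or_lt
  · rw [isNilpotent_iff_wordDistributions_one eG, isNilpotent_iff_wordDistributions_one eH, h]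
  · rw [isNilpotent_iff_wordDistributions_of_two_le hn eG,
      isNilpotent_iff_wordDistributions_of_two_le hn eH, h]
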